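/- Let $G=(V,E)$ be a simple connected graph on $n$ vertices, and let $d(v)$ denote the degree of $v$. Consider the random walk on $G$ with the minimum-degree conductances $c(u,v)=\frac{1}{\min[d(u),d(v)]}$ for $(u,v)\in E$: from a vertex $v$ it moves to each neighbour $u$ of $v$ with probability $\frac{c(v,u)}{\sum_{w\in N(v)}c(v,w)}$, where $N(v)$ is the set of neighbours of $v$ (if $n=1$, it stays put). For vertices $u,v$ let $H[u,v]$ be the expected number of steps that the walk started at $u$ takes to reach $v$ (with $H[v,v]=0$). Then the cyclic cover time of the walk satisfies $$\min_{(v_1,\dots,v_n)}\Big(H[v_1,v_2]+H[v_2,v_3]+\dots+H[v_{n-1},v_n]+H[v_n,v_1]\Big)\le 18n^2,$$ where the minimum is over all orderings $(v_1,\dots,v_n)$ of $V$. In particular, the cover time of the walk (the expected number of steps to visit all vertices, from the worst starting vertex) is also at most $18n^2$, hence $O(n^2)$ with an absolute constant; this is the bound conjectured by Abdullah, Cooper and Draief. -/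

import Mathlib

open MeasureTheory ProbabilityTheory
open scoped ENNReal NNReal

noncomputable section

namespace GraphWalk

variable {V : Type*} [Fintype V] [DecidableEq V]

/-- The minimum degree weighting scheme: the edge `{u, v}` gets conductance
`1 / min (d(u), d(v))`. Only the values at edges of `G` matter. -/
def minDegreeConductance (G : SimpleGraph V) [DecidableRel G.Adj] : Sym2 V → ℝ≥0 :=
  Sym2.lift ⟨fun u v => 1 / ((min (G.degree u) (G.degree v) : ℕ) : ℝ≥0),
    fun u v => by simp only [min_comm]⟩

/-- The total conductance `∑_{w ∈ N(v)} c(v, w)` of the edges at `v`. -/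
def totalConductance (G : SimpleGraph V) [DecidableRel G.Adj] (c : Sym2 V → ℝ≥0) (v : V) :
    ℝ≥0 :=
  ∑ w ∈ G.neighborFinset v, c s(v, w)

/-- One step of the random walk from `v`: a neighbour `u` of `v` is chosen with probability
`c(v, u) / ∑_{w ∈ N(v)} c(v, w)`. If no edge at `v` has positive conductance (in a connected graph
with positive conductances: only if `v` is the only vertex), then the walk stays at `v`. -/
def step (G : SimpleGraph V) [DecidableRel G.Adj] (c : Sym2 V → ℝ≥0) (v : V) : PMF V :=
  if h : totalConductance G c v = 0 then PMF.pure v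
  else PMF.ofFintype
    (fun u => ((if G.Adj v u then c s(v, u) / totalConductance G c v else 0 : ℝ≥0) : ℝ≥0∞))
    (by
      rw [← ENNReal.ofNNReal_finsetSum, ← Finset.sum_filter, ← Finset.sum_div,
        ← SimpleGraph.neighborFinset_eq_filter]
      exact congrArg _ (div_self h))

variable [MeasurableSpace V] [DiscreteMeasurableSpace V]

/-- The one-step transition kernel of the random walk. -/
def stepKernel (G : SimpleGraph V) [DecidableRel G.Adj] (c : Sym2 V → ℝ≥0) : Kernel V V where
  toFun v := (step G c v).toMeasure
  measurable' := Measurable.of_discrete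

instance (G : SimpleGraph V) [DecidableRel G.Adj] (c : Sym2 V → ℝ≥0) :
    IsMarkovKernel (stepKernel G c) :=
  ⟨fun v => inferInstanceAs (IsProbabilityMeasure (step G c v).toMeasure)⟩

/-- The conditional law of the position at time `n + 1`, given the positions at times
`0, …, n`: a step of the walk from the position at time `n`. -/
def pathKernel (G : SimpleGraph V) [DecidableRel G.Adj] (c : Sym2 V → ℝ≥0) (n : ℕ) :
    Kernel (Finset.Iic n → V) V :=
  (stepKernel G c).comap (fun x => x ⟨n, Finset.mem_Iic.2 le_rfl⟩) (measurable_pi_apply _)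

instance (G : SimpleGraph V) [DecidableRel G.Adj] (c : Sym2 V → ℝ≥0) (n : ℕ) :
    IsMarkovKernel (pathKernel G c n) := by
  unfold pathKernel; infer_instance

/-- The law, on the space of trajectories `ℕ → V`, of the random walk on `G` with conductances
`c` started at `u` (the Ionescu-Tulcea measure of the transition kernels). -/
def walkLaw (G : SimpleGraph V) [DecidableRel G.Adj] (c : Sym2 V → ℝ≥0) (u : V) :
    Measure (ℕ → V) :=
  Kernel.traj (X := fun _ => V) (pathKernel G c) 0 (fun _ => u)

/-- The first time at which the trajectory `ω` is at `v` (`∞` if it never is). -/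
def firstVisit (v : V) (ω : ℕ → V) : ℝ≥0∞ :=
  ⨅ (t : ℕ) (_ : ω t = v), (t : ℝ≥0∞)

/-- The first time by which the trajectory `ω` has visited all vertices (`∞` if it never
does). -/
def coverStep (ω : ℕ → V) : ℝ≥0∞ :=
  ⨅ (t : ℕ) (_ : ∀ v, ∃ s ≤ t, ω s = v), (t : ℝ≥0∞)

/-- The hitting time `H[u, v]`: the expected number of steps that the walk started at `u` takes to
reach `v`. -/
def hittingTime (G : SimpleGraph V) [DecidableRel G.Adj] (c : Sym2 V → ℝ≥0) (u v : V) : ℝ≥0∞ :=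
  ∫⁻ ω, firstVisit v ω ∂(walkLaw G c u)

/-- The cover time: the expected number of steps that the walk takes to visit all vertices, from
the worst starting vertex. -/
def coverTime (G : SimpleGraph V) [DecidableRel G.Adj] (c : Sym2 V → ℝ≥0) : ℝ≥0∞ :=
  ⨆ u : V, ∫⁻ ω, coverStep ω ∂(walkLaw G c u)

/-- The cyclic cover time: the minimum over all enumerations `v₀, …, vₙ₋₁` of the vertices of
`H[v₀, v₁] + H[v₁, v₂] + ⋯ + H[vₙ₋₂, vₙ₋₁] + H[vₙ₋₁, v₀]`; `finRotate` is the map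
`i ↦ i + 1` modulo `n`. -/
def cyclicCoverTime (G : SimpleGraph V) [DecidableRel G.Adj] (c : Sym2 V → ℝ≥0) : ℝ≥0∞ :=
  ⨅ σ : Fin (Fintype.card V) ≃ V, ∑ i, hittingTime G c (σ i) (σ (finRotate _ i))

end GraphWalk

end

/-! Let `h x v` solve the linear equations of the hitting times, let `K x y = h x y + h y x`, let
`M` be the sum of the total conductances of all vertices, and let `n` be the number of vertices.
Since `1 / min(a, b) ≤ 1 / a + 1 / b`, `M ≤ 2n`. Foster's theorem says that `c * K` sums to `(n - 1)
* M` over the edges, and each edge has `c * K ≤ M`, hence `K ≤ M * min(d(x), d(y))`.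

Kruskal's algorithm with lengths `K` yields a closed tour: by the triangle inequality, two disjoint
tours merge along an edge at the extra cost `K` of that edge. Rank the vertices injectively and
compatibly with degree, and charge each merge to the top-ranked vertex `u` of the block `B u` whose
top rank is smaller. Each vertex pays at most once, and its payment `b u` is at most `K` of every
edge leaving `B u`.

To bound `∑ b u` (`sum_merge_cost_le`), spread `b u` evenly over the neighbours `v` of `u`. If `v ∉
B u`, the share is at most `c * K` of the edge `uv`; Foster bounds these by `2(n - 1)M`. If `v ∈ B
u`, fix `v` and order such `u` by rank: a later `w` lies outside `B u`, so the share of `u` is at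
most `c * K` of the edge `vw`. Shifting by one place, only the last share is not paid by an edge,
and it is at most `M`; edges are used in one direction only, so the total is `(n - 1)M + nM`.
Altogether the tour costs at most `(4n - 3)M ≤ 8n²`.

The actual expectations are bounded by `h` through a drift argument (`lintegral_stopTime_le`); only
upper bounds are needed. -/

namespace GraphWalk

/-! ### Hitting times as potentials, and Foster's theorem -/

section Potential

variable {V : Type*} [Fintype V]

/-- The (unnormalised) Laplacian of a weighted graph. -/
def laplacian (c : V → V → ℝ) (f : V → ℝ) (x : V) : ℝ :=
  ∑ w, c x w * (f x - f w)

theorem laplacian_sub (c : V → V → ℝ) (f g : V → ℝ) (x : V) :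
    laplacian c (fun y => f y - g y) x = laplacian c f x - laplacian c g x := by
  simp only [laplacian, ← Finset.sum_sub_distrib]
  exact Finset.sum_congr rfl fun w _ => by ring

theorem laplacian_add_const (c : V → V → ℝ) (f : V → ℝ) (a : ℝ) (x : V) :
    laplacian c (fun y => f y + a) x = laplacian c f x := by
  simp [laplacian]

theorem sum_laplacian (c : V → V → ℝ) (hs : ∀ x y, c x y = c y x) (f : V → ℝ) :
    ∑ x, laplacian c f x = 0 := by
  have h : ∑ x, laplacian c f x = ∑ x, ∑ w, c x w * f x - ∑ x, ∑ w, c x w * f w := by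
    simp only [laplacian, mul_sub, Finset.sum_sub_distrib]
  rw [h, Finset.sum_comm (f := fun x w => c x w * f w), sub_eq_zero]
  exact Finset.sum_congr rfl fun x _ => Finset.sum_congr rfl fun w _ => by rw [hs]

/-- Minimum principle: a function that is nonnegative on a nonempty set `A` and superharmonic off
`A` is nonnegative. -/
theorem minimum_principle {G : SimpleGraph V} (hG : G.Connected) {c : V → V → ℝ}
    (h0 : ∀ x y, 0 ≤ c x y) (hpos : ∀ x y, G.Adj x y → 0 < c x y) {A : Set V}
    (hA : A.Nonempty) {f : V → ℝ} (hfA : ∀ x ∈ A, 0 ≤ f x)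
    (hf : ∀ x, x ∉ A → 0 ≤ laplacian c f x) (x : V) : 0 ≤ f x := by
  classical
  have : Nonempty V := ⟨x⟩
  obtain ⟨z, hz⟩ := Finite.exists_min f
  by_contra! hx
  have hneg : f z < 0 := (hz x).trans_lt hx
  obtain ⟨a, ha⟩ := hA
  -- A negative minimum lies off `A`. There the Laplacian is both nonnegative and a sum of
  -- nonpositive terms, so all neighbours share the minimal value; this spreads along walks until it
  -- reaches `A`.
  have key : ∀ y, G.Reachable z y → f y = f z := by
    rintro y ⟨p⟩
    induction p with
    | nil => rfl
    | @cons u v w huv p ih =>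
      have hu : u ∉ A := fun h => absurd (hfA u h) (not_le.2 hneg)
      have h1 := hf u hu
      have hle : ∀ w ∈ Finset.univ, c u w * (f u - f w) ≤ 0 := fun w _ =>
        mul_nonpos_of_nonneg_of_nonpos (h0 u w) (sub_nonpos.2 (hz w))
      have h2 : c u v * (f u - f v) = 0 := by
        have := (Finset.sum_eq_zero_iff_of_nonpos hle).1
          (le_antisymm (Finset.sum_nonpos hle) h1) v (Finset.mem_univ v)
        exact this
      have h3 : f v = f u := by
        rcases mul_eq_zero.1 h2 with h | h
        · exact absurd h (hpos u v huv).ne'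
        · linarith
      rw [← h3]
      exact ih (fun w => h3 ▸ hz w) (h3 ▸ hneg)
  have := hfA a ha
  rw [key a (hG.preconnected z a)] at this
  exact absurd this (not_le.2 hneg)

/-- The expected hitting times, as the solution of their linear equations. -/
theorem exists_hitting_potential [DecidableEq V] {G : SimpleGraph V} (hG : G.Connected)
    {c : V → V → ℝ} (h0 : ∀ x y, 0 ≤ c x y) (hpos : ∀ x y, G.Adj x y → 0 < c x y) (v : V) :
    ∃ f : V → ℝ, f v = 0 ∧ ∀ x, x ≠ v → laplacian c f x = ∑ w, c x w := by
  -- The Dirichlet problem as a square linear system: the minimum principle gives injectivity, and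
  -- finite dimension turns this into surjectivity.
  let L : (V → ℝ) →ₗ[ℝ] (V → ℝ) :=
    { toFun := fun f x => if x = v then f x else laplacian c f x
      map_add' := by
        intro f g
        funext x
        by_cases hx : x = v
        · simp [hx]
        · simp only [hx, if_false, Pi.add_apply, laplacian, ← Finset.sum_add_distrib]
          exact Finset.sum_congr rfl fun w _ => by ring
      map_smul' := by
        intro a f
        funext x
        by_cases hx : x = v
        · simp [hx]
        · simp only [hx, if_false, Pi.smul_apply, smul_eq_mul, laplacian, RingHom.id_apply,
            Finset.mul_sum]
          exact Finset.sum_congr rfl fun w _ => by ring }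
  have hL : ∀ f x, L f x = if x = v then f x else laplacian c f x := fun _ _ => rfl
  have nonneg : ∀ f, (∀ x, 0 ≤ L f x) → ∀ x, 0 ≤ f x := by
    intro f hf
    refine minimum_principle hG h0 hpos (A := {v}) ⟨v, rfl⟩ ?_ ?_
    · rintro x rfl
      simpa [hL] using hf x
    · intro x hx
      have := hf x
      rwa [hL, if_neg (by simpa using hx)] at this
  have inj : Function.Injective L := by
    rw [← LinearMap.ker_eq_bot, LinearMap.ker_eq_bot']
    intro f hf
    funext x
    refine le_antisymm ?_ (nonneg f (fun x => by rw [hf]; rfl) x)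
    have := nonneg (-f) (fun x => by rw [map_neg, hf]; simp) x
    simpa using this
  obtain ⟨f, hf⟩ := (LinearMap.injective_iff_surjective.1 inj)
    (fun x => if x = v then 0 else ∑ w, c x w)
  refine ⟨f, ?_, fun x hx => ?_⟩
  · simpa [hL] using congrFun hf v
  · simpa [hL, hx] using congrFun hf x

/-- `h x v` is the expected hitting time of `v` from `x`, in the sense of the linear equations. -/
structure IsHittingPotential (c : V → V → ℝ) (h : V → V → ℝ) : Prop where
  self : ∀ v, h v v = 0
  laplacian_eq : ∀ v x, x ≠ v → laplacian c (fun y => h y v) x = ∑ w, c x w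

namespace IsHittingPotential

variable {G : SimpleGraph V} {c h : V → V → ℝ}

theorem nonneg (hh : IsHittingPotential c h) (hG : G.Connected) (h0 : ∀ x y, 0 ≤ c x y)
    (hpos : ∀ x y, G.Adj x y → 0 < c x y) (x v : V) : 0 ≤ h x v := by
  refine minimum_principle hG h0 hpos (A := {v}) (f := fun y => h y v) ⟨v, rfl⟩ ?_ ?_ x
  · rintro x rfl
    exact (hh.self x).ge
  · intro x hx
    rw [hh.laplacian_eq v x hx]
    exact Finset.sum_nonneg fun w _ => h0 x w

/-- As functions of the starting point, both sides have the same Laplacian off `{y, z}`, so the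
minimum principle reduces the claim to these two points. -/
theorem triangle (hh : IsHittingPotential c h) (hG : G.Connected) (h0 : ∀ x y, 0 ≤ c x y)
    (hpos : ∀ x y, G.Adj x y → 0 < c x y) (x y z : V) : h x z ≤ h x y + h y z := by
  have h1 := minimum_principle hG h0 hpos (A := {y, z})
    (f := fun a => (h a y + h y z) - h a z) ⟨y, by simp⟩ ?_ ?_ x
  · linarith
  · rintro a (rfl | rfl)
    · simp [hh.self]
    · simp only [hh.self, sub_zero]
      exact add_nonneg (hh.nonneg hG h0 hpos _ _) (hh.nonneg hG h0 hpos _ _)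
  · intro a ha
    simp only [Set.mem_insert_iff, Set.mem_singleton_iff, not_or] at ha
    rw [laplacian_sub c (fun a => h a y + h y z), laplacian_add_const c (fun a => h a y),
      hh.laplacian_eq y a ha.1, hh.laplacian_eq z a ha.2, sub_self]

/-- The expected return time to `v` is `(∑ x, m x) / m v`, where `m x = ∑ w, c x w`. -/
theorem sum_mul_eq (hh : IsHittingPotential c h) (hs : ∀ x y, c x y = c y x) (v : V) :
    ∑ w, c v w * h w v = ∑ x, ∑ w, c x w - ∑ w, c v w := by
  classical
  have h1 := sum_laplacian c hs (fun y => h y v)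
  rw [← Finset.add_sum_erase _ _ (Finset.mem_univ v),
    Finset.sum_congr rfl fun x hx => hh.laplacian_eq v x (Finset.ne_of_mem_erase hx)] at h1
  rw [← Finset.add_sum_erase Finset.univ (fun x => ∑ w, c x w) (Finset.mem_univ v)]
  have h2 : laplacian c (fun y => h y v) v = -∑ w, c v w * h w v := by
    simp [laplacian, hh.self, Finset.sum_neg_distrib]
  linarith

/-- Foster's theorem for commute times. -/
theorem foster (hh : IsHittingPotential c h) (hs : ∀ x y, c x y = c y x) :
    ∑ x, ∑ y, c x y * (h x y + h y x) =
      2 * ((Fintype.card V - 1) * ∑ x, ∑ w, c x w) := by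
  have h1 : ∑ x, ∑ y, c x y * h y x = (Fintype.card V - 1) * ∑ x, ∑ w, c x w := by
    simp only [hh.sum_mul_eq hs, Finset.sum_sub_distrib, Finset.sum_const, Finset.card_univ,
      nsmul_eq_mul]
    ring
  have h2 : ∑ x, ∑ y, c x y * h x y = ∑ x, ∑ y, c x y * h y x := by
    rw [Finset.sum_comm]
    exact Finset.sum_congr rfl fun x _ => Finset.sum_congr rfl fun y _ => by rw [hs]
  simp only [mul_add, Finset.sum_add_distrib]
  rw [h2, h1]
  ring

/-- Adding the equation for target `y` at `x` to the return time identity at `x` writes the right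
side as `∑ w, c x w * (h x y - h w y + h w x)`. Its terms are nonnegative by the triangle
inequality, and `w = y` gives the left side. -/
theorem commute_le (hh : IsHittingPotential c h) (hG : G.Connected) (h0 : ∀ x y, 0 ≤ c x y)
    (hpos : ∀ x y, G.Adj x y → 0 < c x y) (hs : ∀ x y, c x y = c y x) (x y : V) :
    c x y * (h x y + h y x) ≤ ∑ x, ∑ w, c x w := by
  classical
  have hM : 0 ≤ ∑ x, ∑ w, c x w := Finset.sum_nonneg fun x _ => Finset.sum_nonneg fun w _ => h0 x w
  rcases eq_or_ne x y with rfl | hxy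
  · simpa [hh.self] using hM
  have h1 := hh.laplacian_eq y x hxy
  have h2 := hh.sum_mul_eq hs x
  have h3 : c x y * (h x y + h y x) ≤ laplacian c (fun a => h a y) x + ∑ w, c x w * h w x := by
    rw [laplacian, ← Finset.sum_add_distrib]
    calc c x y * (h x y + h y x) = c x y * (h x y - h y y) + c x y * h y x := by
          rw [hh.self]; ring
      _ ≤ _ := by
        refine Finset.single_le_sum (f := fun w => c x w * (h x y - h w y) + c x w * h w x)
          (fun w _ => ?_) (Finset.mem_univ y)
        have := hh.triangle hG h0 hpos w x y
        rw [← mul_add]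
        exact mul_nonneg (h0 x w) (by linarith)
  linarith

end IsHittingPotential

end Potential

/-! ### Closed tours from Kruskal's algorithm -/

section Tour

variable {V : Type*}

/-- The length of the path that starts at a vertex, runs through the list, and ends at `z`. -/
def pathCost (H : V → V → ℝ) : V → List V → V → ℝ
  | a, [], z => H a z
  | a, b :: l, z => H a b + pathCost H b l z

theorem pathCost_append (H : V → V → ℝ) (a x z : V) (s t : List V) :
    pathCost H a (s ++ x :: t) z = pathCost H a s x + pathCost H x t z := by
  induction s generalizing a with
  | nil => rfl
  | cons b s ih => simp only [List.cons_append, pathCost, ih]; ring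

theorem pathCost_le_add {H : V → V → ℝ} (tri : ∀ x y z, H x z ≤ H x y + H y z) (a x z : V)
    (s : List V) : pathCost H a s z ≤ pathCost H a s x + H x z := by
  induction s generalizing a with
  | nil => exact tri a x z
  | cons b s ih => have := ih b; simp only [pathCost]; linarith

/-- From every vertex of the set `S` starts a closed tour of length at most `r` that visits every
vertex of `S` exactly once. -/
def HasTour (H : V → V → ℝ) (S : Set V) (r : ℝ) : Prop :=
  ∀ x ∈ S, ∃ l : List V, (x :: l).Nodup ∧ (∀ y, y ∈ x :: l ↔ y ∈ S) ∧ pathCost H x l x ≤ r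

/-- A closed tour can be rotated to begin at any of its vertices, without change of length. -/
theorem hasTour_of_list {H : V → V → ℝ} {S : Set V} {r : ℝ} {a : V} {l : List V}
    (hnd : (a :: l).Nodup) (hmem : ∀ y, y ∈ a :: l ↔ y ∈ S) (hr : pathCost H a l a ≤ r) :
    HasTour H S r := by
  intro x hx
  rcases List.mem_cons.1 ((hmem x).2 hx) with rfl | hxl
  · exact ⟨l, hnd, hmem, hr⟩
  · obtain ⟨s, t, rfl⟩ := List.append_of_mem hxl
    have hp : (x :: (t ++ a :: s)).Perm (a :: (s ++ x :: t)) := by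
      have : ((x :: t) ++ (a :: s)).Perm ((a :: s) ++ (x :: t)) := List.perm_append_comm
      simpa using this
    refine ⟨t ++ a :: s, hp.nodup_iff.2 hnd, fun y => hp.mem_iff.trans (hmem y), ?_⟩
    rw [pathCost_append] at hr ⊢
    linarith

theorem HasTour.mono {H : V → V → ℝ} {S : Set V} {r r' : ℝ} (h : HasTour H S r) (hr : r ≤ r') :
    HasTour H S r' := fun x hx =>
  let ⟨l, h1, h2, h3⟩ := h x hx
  ⟨l, h1, h2, h3.trans hr⟩

theorem hasTour_singleton {H : V → V → ℝ} (x : V) : HasTour H {x} (H x x) :=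
  hasTour_of_list (a := x) (l := []) (by simp) (by simp) le_rfl

/-- The tour of `S` from `x` is cut before its return to `x`, and the tour of `T` from `y` before
its return to `y`. By the triangle inequality, the two connecting legs cost at most the cut legs
plus `H x y + H y x`. -/
theorem HasTour.union {H : V → V → ℝ} (tri : ∀ x y z, H x z ≤ H x y + H y z) {S T : Set V}
    {r s : ℝ} (hS : HasTour H S r) (hT : HasTour H T s) (hd : Disjoint S T) {x y : V}
    (hx : x ∈ S) (hy : y ∈ T) : HasTour H (S ∪ T) (r + s + (H x y + H y x)) := by
  obtain ⟨l, hl, hlS, hlr⟩ := hS x hx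
  obtain ⟨k, hk, hkT, hkr⟩ := hT y hy
  refine hasTour_of_list (a := x) (l := l ++ y :: k) ?_ ?_ ?_
  · rw [← List.cons_append, List.nodup_append']
    refine ⟨hl, hk, fun z hz1 hz2 => ?_⟩
    exact Set.disjoint_left.1 hd ((hlS z).1 hz1) ((hkT z).1 hz2)
  · intro z
    rw [← List.cons_append, List.mem_append, hlS, hkT, Set.mem_union]
  · rw [pathCost_append]
    have h1 := pathCost_le_add tri x x y l
    have h2 := pathCost_le_add tri y y x k
    linarith

/-- The state of Kruskal's algorithm: `p x` is the vertex of maximal rank in the block of `x`; a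
vertex `u` that has been the maximal one of its block `B u`, until this block was merged with one
of larger maximal rank, has paid the length `b u` of the edge used. -/
structure IsMerging [Fintype V] [DecidableEq V] (G : SimpleGraph V) (H : V → V → ℝ)
    (rank : V → ℕ) (D : V → ℝ) (p : V → V) (b : V → ℝ) (B : V → Set V) : Prop where
  idem : ∀ x, p (p x) = p x
  rank_le : ∀ x, rank x ≤ rank (p x)
  tour : ∀ u, p u = u → HasTour H {x | p x = u} (∑ x with p x = u, b x)
  alive : ∀ u, p u = u → b u = 0
  mem : ∀ u, u ∈ B u
  max : ∀ u, ∀ y ∈ B u, rank y ≤ rank u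
  leave : ∀ u, ∀ y ∈ B u, ∀ z, z ∉ B u → G.Adj y z → b u ≤ H y z + H z y
  le : ∀ u, b u ≤ D u

/-- One Kruskal step: the block of `x` joins that of `y`, and `p x` pays. Minimality among all edges
between blocks gives `leave` for the frozen block of `p x`. -/
theorem IsMerging.merge [Fintype V] [DecidableEq V] {G : SimpleGraph V} {H : V → V → ℝ}
    {rank : V → ℕ} {D : V → ℝ} {p : V → V} {b : V → ℝ} {B : V → Set V}
    (hM : IsMerging G H rank D p b B) (tri : ∀ x y z, H x z ≤ H x y + H y z)
    (hD : ∀ x y, rank x ≤ rank y → D x ≤ D y) (hHD : ∀ x y, G.Adj x y → H x y + H y x ≤ D x)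
    {x y : V} (hxy : G.Adj x y) (hr : rank (p x) < rank (p y))
    (hmin : ∀ z w, G.Adj z w → p z ≠ p w → H x y + H y x ≤ H z w + H w z) :
    IsMerging G H rank D (fun z => if p z = p x then p y else p z)
      (Function.update b (p x) (H x y + H y x)) (Function.update B (p x) {z | p z = p x}) := by
  have hne : p y ≠ p x := fun h => by rw [h] at hr; exact lt_irrefl _ hr
  have alive_iff : ∀ u, (if p u = p x then p y else p u) = u → p u = u ∧ u ≠ p x := by
    intro u hu
    split_ifs at hu with h
    · rw [← hu, hM.idem] at h
      exact absurd h hne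
    · exact ⟨hu, fun h' => h (by rw [h', hM.idem])⟩
  have upd : ∀ u, u ≠ p x → ∑ z with p z = u, Function.update b (p x) (H x y + H y x) z =
      ∑ z with p z = u, b z := fun u hu => Finset.sum_congr rfl fun z hz => by
    refine Function.update_of_ne (fun h => hu ?_) _ _
    rw [← (Finset.mem_filter.1 hz).2, h, hM.idem]
  refine ⟨?_, ?_, ?_, ?_, ?_, ?_, ?_, ?_⟩
  · intro z
    by_cases hz : p z = p x
    · simp [hz, hM.idem, hne]
    · simp [hz, hM.idem]
  · intro z
    by_cases hz : p z = p x
    · simp only [hz, if_true]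
      exact (hz ▸ hM.rank_le z).trans hr.le
    · simpa [hz] using hM.rank_le z
  · intro u hu
    obtain ⟨hu1, hu2⟩ := alive_iff u hu
    by_cases huy : u = p y
    · have hset : {z | (if p z = p x then p y else p z) = u} =
          {z | p z = p x} ∪ {z | p z = p y} := by
        ext z
        by_cases hz : p z = p x <;> simp [hz, huy]
      have hsum : ∑ z with (if p z = p x then p y else p z) = u,
            Function.update b (p x) (H x y + H y x) z =
          ∑ z with p z = p x, b z + ∑ z with p z = p y, b z + (H x y + H y x) := by
        have hf : (Finset.univ.filter fun z => (if p z = p x then p y else p z) = u) =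
            Finset.univ.filter (fun z => p z = p x) ∪ Finset.univ.filter fun z => p z = p y := by
          ext z
          by_cases hz : p z = p x <;> simp [hz, huy]
        have hdis : Disjoint (Finset.univ.filter fun z => p z = p x)
            (Finset.univ.filter fun z => p z = p y) := by
          rw [Finset.disjoint_filter]
          exact fun z _ h1 h2 => hne (h2.symm.trans h1)
        -- Before the merge `p x` has paid nothing, so overwriting its payment raises the sum by
        -- exactly the length of the new edge.
        have hpx : p x ∈ Finset.univ.filter fun z => p z = p x := by simp [hM.idem]
        rw [hf, Finset.sum_union hdis, upd _ hne, Finset.sum_update_of_mem hpx,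
          ← Finset.add_sum_erase _ b hpx, hM.alive _ (hM.idem x), Finset.sdiff_singleton_eq_erase]
        ring
      rw [hset, hsum]
      refine (hM.tour _ (hM.idem x)).union tri (hM.tour _ (hM.idem y)) ?_ rfl rfl
      rw [Set.disjoint_left]
      exact fun z h1 h2 => hne (h2.symm.trans h1)
    · have hiff : ∀ z, (if p z = p x then p y else p z) = u ↔ p z = u := by
        intro z
        by_cases hz : p z = p x
        · simp only [hz, if_true]
          exact ⟨fun h => absurd h.symm huy, fun h => absurd h.symm hu2⟩
        · simp [hz]
      simp only [hiff]
      rw [upd u hu2]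
      exact hM.tour u hu1
  · intro u hu
    obtain ⟨hu1, hu2⟩ := alive_iff u hu
    rw [Function.update_of_ne hu2, hM.alive u hu1]
  · intro u
    by_cases hu : u = p x
    · subst hu; simp [hM.idem]
    · rw [Function.update_of_ne hu]; exact hM.mem u
  · intro u z hz
    by_cases hu : u = p x
    · subst hu
      rw [Function.update_self] at hz
      exact hz ▸ hM.rank_le z
    · rw [Function.update_of_ne hu] at hz
      exact hM.max u z hz
  · intro u z hz w hw hzw
    by_cases hu : u = p x
    · subst hu
      rw [Function.update_self] at hz hw ⊢
      exact hmin z w hzw fun h => hw (h.symm.trans hz)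
    · rw [Function.update_of_ne hu] at hz hw ⊢
      exact hM.leave u z hz w hw hzw
  · intro u
    by_cases hu : u = p x
    · subst hu
      rw [Function.update_self]
      exact (hHD x y hxy).trans (hD _ _ (hM.rank_le x))
    · rw [Function.update_of_ne hu]
      exact hM.le u

/-- Induction on the number of blocks: connectedness supplies an edge between two blocks, and
merging along a cheapest one removes a representative. -/
theorem IsMerging.exists_final [Fintype V] [DecidableEq V] {G : SimpleGraph V}
    (hG : G.Connected) {H : V → V → ℝ} {rank : V → ℕ} (hrank : Function.Injective rank)
    {D : V → ℝ} (tri : ∀ x y z, H x z ≤ H x y + H y z)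
    (hD : ∀ x y, rank x ≤ rank y → D x ≤ D y) (hHD : ∀ x y, G.Adj x y → H x y + H y x ≤ D x)
    (k : ℕ) : ∀ {p : V → V} {b : V → ℝ} {B : V → Set V}, IsMerging G H rank D p b B →
      (Finset.univ.image p).card ≤ k →
      ∃ p b B, IsMerging G H rank D p b B ∧ ∀ x y, p x = p y := by
  induction k with
  | zero =>
    intro p b B hM hk
    obtain ⟨x⟩ := hG.nonempty
    exact absurd (Finset.card_pos.2 ⟨p x, Finset.mem_image_of_mem p (Finset.mem_univ x)⟩)
      (not_lt.2 hk)
  | succ k ih =>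
    intro p b B hM hk
    by_cases hall : ∀ x y, p x = p y
    · exact ⟨p, b, B, hM, hall⟩
    · have hex : ∃ e : V × V, G.Adj e.1 e.2 ∧ p e.1 ≠ p e.2 := by
        by_contra! hno
        refine hall fun x y => ?_
        obtain ⟨w⟩ := hG.preconnected x y
        induction w with
        | nil => rfl
        | cons h _ ih => exact (hno (_, _) h).trans ih
      obtain ⟨e, he, hmin⟩ := Set.exists_min_image
        {e : V × V | G.Adj e.1 e.2 ∧ p e.1 ≠ p e.2} (fun e => H e.1 e.2 + H e.2 e.1)
        (Set.toFinite _) hex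
      obtain ⟨x, y, hxy, hr, hm⟩ : ∃ x y, G.Adj x y ∧ rank (p x) < rank (p y) ∧
          ∀ z w, G.Adj z w → p z ≠ p w → H x y + H y x ≤ H z w + H w z := by
        rcases lt_or_gt_of_ne (fun h => he.2 (hrank h)) with h | h
        · exact ⟨e.1, e.2, he.1, h, fun z w h1 h2 => hmin (z, w) ⟨h1, h2⟩⟩
        · exact ⟨e.2, e.1, he.1.symm, h, fun z w h1 h2 => by
            rw [add_comm]; exact hmin (z, w) ⟨h1, h2⟩⟩
      refine ih (hM.merge tri hD hHD hxy hr hm) ?_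
      have hne : p y ≠ p x := fun h => by rw [h] at hr; exact lt_irrefl _ hr
      have hsub : (Finset.univ.image fun z => if p z = p x then p y else p z) ⊆
          (Finset.univ.image p).erase (p x) := by
        intro a ha
        obtain ⟨z, -, rfl⟩ := Finset.mem_image.1 ha
        by_cases hz : p z = p x
        · simp [hz, hne]
        · simp [hz]
      have h1 := Finset.card_le_card hsub
      rw [Finset.card_erase_of_mem (Finset.mem_image_of_mem p (Finset.mem_univ x))] at h1
      omega

/-- There is a closed tour of length at most `∑ u, b u`, where every edge that leaves `B u` has
length at least `b u`, and `u` has maximal rank in `B u`. -/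
theorem exists_tour [Fintype V] [DecidableEq V] {G : SimpleGraph V}
    (hG : G.Connected) {H : V → V → ℝ} {rank : V → ℕ} (hrank : Function.Injective rank)
    {D : V → ℝ} (hself : ∀ x, H x x = 0) (hnn : ∀ x y, 0 ≤ H x y)
    (tri : ∀ x y z, H x z ≤ H x y + H y z) (hD0 : ∀ x, 0 ≤ D x)
    (hD : ∀ x y, rank x ≤ rank y → D x ≤ D y)
    (hHD : ∀ x y, G.Adj x y → H x y + H y x ≤ D x) :
    ∃ (b : V → ℝ) (B : V → Set V), HasTour H Set.univ (∑ u, b u) ∧ (∀ u, u ∈ B u) ∧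
      (∀ u, ∀ y ∈ B u, rank y ≤ rank u) ∧
      (∀ u, ∀ y ∈ B u, ∀ z, z ∉ B u → G.Adj y z → b u ≤ H y z + H z y) ∧
      ∀ u, b u ≤ D u := by
  have hinit : IsMerging G H rank D id (fun _ => 0) (fun u => {u}) :=
    { idem := fun _ => rfl
      rank_le := fun _ => le_rfl
      tour := fun u _ => by
        have := hasTour_singleton (H := H) u
        simpa [hself] using this
      alive := fun _ _ => rfl
      mem := fun _ => rfl
      max := fun u y hy => by rw [Set.mem_singleton_iff.1 hy]
      leave := fun _ y _ z _ _ => add_nonneg (hnn y z) (hnn z y)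
      le := hD0 }
  obtain ⟨p, b, B, hM, hp⟩ := hinit.exists_final hG hrank tri hD hHD _ le_rfl
  obtain ⟨x⟩ := hG.nonempty
  refine ⟨b, B, ?_, hM.mem, hM.max, hM.leave, hM.le⟩
  have h := hM.tour (p x) (hM.idem x)
  have h1 : ∀ y, p y = p x := fun y => hp y x
  simpa [h1] using h

end Tour

/-! ### The degree charging argument -/

/-- In order of rank, each `y` is bounded by the next `x`, and the last `y` by `q`. Removing the
maximal element `a` leaves the same problem with `x a` in place of `q`. -/
theorem sum_le_sum_add_of_chain {ι : Type*} (rank : ι → ℕ) {y x : ι → ℝ} (hx : ∀ u, 0 ≤ x u)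
    (s : Finset ι) :
    (∀ u ∈ s, ∀ w ∈ s, u ≠ w → rank u ≤ rank w → y u ≤ x w) →
      ∀ q, 0 ≤ q → (∀ u ∈ s, y u ≤ q) → ∑ u ∈ s, y u ≤ ∑ u ∈ s, x u + q := by
  classical
  induction s using Finset.induction_on_max_value rank with
  | empty => intro _ q hq _; simpa using hq
  | insert a s ha hmax ih =>
    intro h q _ hyq
    rw [Finset.sum_insert ha, Finset.sum_insert ha]
    have h1 := ih (fun u hu w hw => h u (Finset.mem_insert_of_mem hu) w
      (Finset.mem_insert_of_mem hw)) (x a) (hx a) (fun u hu => h u (Finset.mem_insert_of_mem hu) a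
        (Finset.mem_insert_self a s) (fun h' => ha (h' ▸ hu)) (hmax u hu))
    have h2 := hyq a (Finset.mem_insert_self a s)
    linarith

section Degree

variable {V : Type*} [Fintype V]

/-- The sum of the values `b u` is at most linear in the number of vertices, if the edges that leave
the sets `B u` satisfy the bounds of `exists_tour`, and the lengths satisfy Foster's theorem. -/
theorem sum_merge_cost_le {G : SimpleGraph V} [DecidableRel G.Adj] {rank : V → ℕ}
    (hrank : Function.Injective rank)
    (hdeg : ∀ x y, rank x ≤ rank y → G.degree x ≤ G.degree y) (hpos : ∀ x, 0 < G.degree x)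
    {K : V → V → ℝ} (hK0 : ∀ x y, 0 ≤ K x y) (hKs : ∀ x y, K x y = K y x) {M F : ℝ} (hM : 0 ≤ M)
    (hF : ∑ x, ∑ y ∈ G.neighborFinset x, K x y / min (G.degree x : ℝ) (G.degree y) ≤ 2 * F)
    {b : V → ℝ} {B : V → Set V} (hmem : ∀ u, u ∈ B u)
    (hmax : ∀ u, ∀ y ∈ B u, rank y ≤ rank u)
    (hleave : ∀ u, ∀ y ∈ B u, ∀ z, z ∉ B u → G.Adj y z → b u ≤ K y z)
    (hle : ∀ u, b u ≤ M * G.degree u) :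
    ∑ u, b u ≤ 3 * F + Fintype.card V * M := by
  classical
  have hd : ∀ x, (0 : ℝ) < G.degree x := fun x => Nat.cast_pos.2 (hpos x)
  set R : V → V → ℝ := fun x y => min (G.degree x : ℝ) (G.degree y) with hR
  have hRpos : ∀ x y, 0 < R x y := fun x y => lt_min (hd x) (hd y)
  have hRs : ∀ x y, R x y = R y x := fun x y => min_comm _ _
  have hKR : ∀ x y, 0 ≤ K x y / R x y := fun x y => div_nonneg (hK0 x y) (hRpos x y).le
  have outer : ∑ u, ∑ v ∈ G.neighborFinset u with v ∉ B u, b u / G.degree u ≤ 2 * F := by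
    refine le_trans (Finset.sum_le_sum fun u _ => ?_) hF
    rw [Finset.sum_filter]
    refine Finset.sum_le_sum fun v hv => ?_
    by_cases h : v ∈ B u
    · simpa [h] using hKR u v
    · rw [if_pos h]
      have huv : G.Adj u v := (G.mem_neighborFinset u v).1 hv
      exact div_le_div₀ (hK0 u v) (hleave u u (hmem u) v h huv) (hRpos u v) (min_le_left _ _)
  -- Injectivity of the rank orients every edge, so one direction carries half of the symmetric sum.
  have half : ∑ v, ∑ u ∈ G.neighborFinset v with rank v < rank u, K v u / R v u ≤ F := by
    have h1 : ∑ v, ∑ u ∈ G.neighborFinset v with rank v < rank u, K v u / R v u =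
        ∑ v, ∑ u ∈ G.neighborFinset v with ¬ rank v < rank u, K v u / R v u := by
      simp only [Finset.sum_filter, SimpleGraph.neighborFinset_eq_filter]
      rw [Finset.sum_comm]
      refine Finset.sum_congr rfl fun v _ => Finset.sum_congr rfl fun u _ => ?_
      by_cases huv : G.Adj u v
      · have hne : rank u ≠ rank v := fun h => huv.ne (hrank h)
        have hiff : rank u < rank v ↔ ¬ rank v < rank u := by omega
        simp only [huv, huv.symm, if_true, hiff]
        rw [hKs, hRs]
      · have huv' : ¬ G.Adj v u := fun h => huv h.symm
        simp only [huv, huv', if_false]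
    have h2 : ∑ v, ∑ u ∈ G.neighborFinset v with rank v < rank u, K v u / R v u +
        ∑ v, ∑ u ∈ G.neighborFinset v with ¬ rank v < rank u, K v u / R v u ≤ 2 * F := by
      rw [← Finset.sum_add_distrib]
      simp only [Finset.sum_filter_add_sum_filter_not]
      exact hF
    linarith
  have inner : ∑ u, ∑ v ∈ G.neighborFinset u with v ∈ B u, b u / G.degree u ≤
      F + Fintype.card V * M := by
    have hswap : ∑ u, ∑ v ∈ G.neighborFinset u with v ∈ B u, b u / G.degree u =
        ∑ v, ∑ u ∈ G.neighborFinset v with v ∈ B u, b u / G.degree u := by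
      refine Finset.sum_comm' fun u v => ?_
      simp [G.adj_comm]
    have hbound : ∀ v, ∑ u ∈ G.neighborFinset v with v ∈ B u, b u / G.degree u ≤
        ∑ u ∈ G.neighborFinset v with rank v < rank u, K v u / R v u + M := by
      intro v
      refine (sum_le_sum_add_of_chain rank (x := fun u => K v u / R v u) (fun u => hKR v u) _ ?_
        M hM ?_).trans ?_
      · intro u hu w hw hne huw
        simp only [Finset.mem_filter, SimpleGraph.mem_neighborFinset] at hu hw
        -- As `u` has top rank in `B u`, the edge `vw` leaves `B u`. Moreover `v ∈ B u` gives `d(v)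
        -- ≤ d(u)`, so the minimum degree on `vw` is at most `d(u)`.
        have hw' : w ∉ B u := fun h => hne (hrank (le_antisymm huw (hmax u w h)))
        refine div_le_div₀ (hK0 v w) (hleave u v hu.2 w hw' hw.1) (hRpos v w) ?_
        exact (min_le_left _ _).trans (Nat.cast_le.2 (hdeg v u (hmax u v hu.2)))
      · intro u _
        rw [div_le_iff₀ (hd u)]
        exact hle u
      · refine add_le_add (Finset.sum_le_sum_of_subset_of_nonneg ?_ fun u _ _ => hKR v u) le_rfl
        intro u hu
        simp only [Finset.mem_filter, SimpleGraph.mem_neighborFinset] at hu ⊢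
        exact ⟨hu.1, lt_of_le_of_ne (hmax u v hu.2) fun h => hu.1.ne (hrank h)⟩
    rw [hswap]
    refine (Finset.sum_le_sum fun v _ => hbound v).trans ?_
    rw [Finset.sum_add_distrib, Finset.sum_const, Finset.card_univ, nsmul_eq_mul]
    linarith
  have split : ∑ u, b u = ∑ u, ∑ v ∈ G.neighborFinset u with v ∈ B u, b u / G.degree u +
      ∑ u, ∑ v ∈ G.neighborFinset u with v ∉ B u, b u / G.degree u := by
    rw [← Finset.sum_add_distrib]
    refine Finset.sum_congr rfl fun u _ => ?_
    rw [Finset.sum_filter_add_sum_filter_not, Finset.sum_const, G.card_neighborFinset_eq_degree,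
      nsmul_eq_mul, mul_div_cancel₀ _ (hd u).ne']
  linarith

end Degree

end GraphWalk

/-! ### From drift inequalities to expected times of the walk -/

noncomputable section

namespace GraphWalk

section Visited

variable {V : Type*} [DecidableEq V]

/-- The set of vertices that a trajectory visits up to time `t`. -/
def visited (t : ℕ) (ω : ℕ → V) : Finset V :=
  (Finset.range (t + 1)).image ω

theorem mem_visited {t : ℕ} {ω : ℕ → V} {v : V} : v ∈ visited t ω ↔ ∃ s ≤ t, ω s = v := by
  simp [visited]

theorem visited_succ (t : ℕ) (ω : ℕ → V) : visited (t + 1) ω = insert (ω (t + 1)) (visited t ω) := by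
  rw [visited, Finset.range_add_one, Finset.image_insert, visited]

theorem visited_eq_image (t : ℕ) (ω : ℕ → V) :
    visited t ω = Finset.univ.image (Preorder.frestrictLe t ω) := by
  ext v
  simp [mem_visited]

theorem visited_zero (ω : ℕ → V) : visited 0 ω = {ω 0} := by
  simp [visited]

theorem mem_visited_self (t : ℕ) (ω : ℕ → V) : ω t ∈ visited t ω :=
  mem_visited.2 ⟨t, le_rfl, rfl⟩

/-- The first time at which the set of visited vertices satisfies `D`. -/
def stopTime (D : Finset V → Prop) (ω : ℕ → V) : ℝ≥0∞ :=
  ⨅ (t : ℕ) (_ : D (visited t ω)), (t : ℝ≥0∞)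

-- Every time before the first success contributes `1`; without success the series diverges. The
-- expectation thus becomes a sum of probabilities.
open Classical in
theorem stopTime_le_tsum (D : Finset V → Prop) (ω : ℕ → V) :
    stopTime D ω ≤ ∑' t, if D (visited t ω) then (0 : ℝ≥0∞) else 1 := by
  by_cases h : ∃ t, D (visited t ω)
  · calc stopTime D ω ≤ (Nat.find h : ℝ≥0∞) := iInf₂_le (Nat.find h) (Nat.find_spec h)
      _ = ∑ t ∈ Finset.range (Nat.find h), if D (visited t ω) then (0 : ℝ≥0∞) else 1 := by
        rw [Finset.sum_congr rfl fun t ht => if_neg (Nat.find_min h (Finset.mem_range.1 ht))]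
        simp
      _ ≤ _ := ENNReal.sum_le_tsum _
  · push Not at h
    simp [h]

/-- The length of the path that starts at a vertex and runs through the list. -/
def openPathCost (h : V → V → ℝ≥0∞) : V → List V → ℝ≥0∞
  | _, [] => 0
  | a, b :: l => h a b + openPathCost h b l

/-- The length of the path that goes to the first vertex of the list outside `S` and then runs
through the rest of the list. -/
def remainingCost (h : V → V → ℝ≥0∞) (S : Finset V) (x : V) : List V → ℝ≥0∞
  | [] => 0
  | v :: l => if v ∈ S then remainingCost h S x l else h x v + openPathCost h v l

theorem remainingCost_le {h : V → V → ℝ≥0∞} (tri : ∀ x y z, h x z ≤ h x y + h y z) (S : Finset V)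
    (x : V) (l : List V) : remainingCost h S x l ≤ openPathCost h x l := by
  have hskip : ∀ (v : V) (l : List V), openPathCost h x l ≤ h x v + openPathCost h v l := by
    intro v l
    cases l with
    | nil => exact zero_le
    | cons w l =>
      simp only [openPathCost]
      rw [← add_assoc]
      exact add_le_add (tri _ _ _) le_rfl
  induction l with
  | nil => exact le_rfl
  | cons v l ih =>
    simp only [remainingCost, openPathCost]
    split_ifs
    · exact ih.trans (hskip v l)
    · exact le_rfl

end Visited

theorem sum_step {V : Type*} [Fintype V] (G : SimpleGraph V) [DecidableRel G.Adj]
    (c : Sym2 V → ℝ≥0) (x : V) :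
    ∑ w, step G c x w = 1 := by
  rw [← tsum_fintype (L := SummationFilter.unconditional V)]
  exact (step G c x).tsum_coe

/-- The walk heads for the first unvisited vertex `v` of the list, and `h · v` drops by at least one
on average. A step that visits further listed vertices only lowers the remaining cost, by the
triangle inequality. -/
theorem remainingCost_step {V : Type*} [Fintype V] [DecidableEq V] (G : SimpleGraph V)
    [DecidableRel G.Adj] (c : Sym2 V → ℝ≥0)
    {h : V → V → ℝ≥0∞} (hh : ∀ v x, x ≠ v → 1 + ∑ w, step G c x w * h w v ≤ h x v)
    (tri : ∀ x y z, h x z ≤ h x y + h y z) {S : Finset V} {x : V} (hx : x ∈ S) (l : List V)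
    (hl : ∃ v ∈ l, v ∉ S) :
    1 + ∑ w, step G c x w * remainingCost h (insert w S) w l ≤ remainingCost h S x l := by
  induction l with
  | nil => simp at hl
  | cons v l ih =>
    by_cases hv : v ∈ S
    · have hl' : ∃ v ∈ l, v ∉ S := by
        obtain ⟨w, hw, hwS⟩ := hl
        rcases List.mem_cons.1 hw with rfl | hw
        · exact absurd hv hwS
        · exact ⟨w, hw, hwS⟩
      simpa [remainingCost, hv] using ih hl'
    · have h1 : ∀ w, remainingCost h (insert w S) w (v :: l) ≤ h w v + openPathCost h v l := by
        intro w
        exact remainingCost_le tri _ _ _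
      calc 1 + ∑ w, step G c x w * remainingCost h (insert w S) w (v :: l)
          ≤ 1 + ∑ w, step G c x w * (h w v + openPathCost h v l) := by
            gcongr with w
            exact h1 w
        _ = (1 + ∑ w, step G c x w * h w v) + openPathCost h v l := by
            simp only [mul_add, Finset.sum_add_distrib, ← Finset.sum_mul, sum_step, one_mul,
              add_assoc]
        _ ≤ h x v + openPathCost h v l := add_le_add (hh v x fun h' => hv (h' ▸ hx)) le_rfl
        _ = remainingCost h S x (v :: l) := by simp [remainingCost, hv]

instance {V : Type*} [Fintype V] [MeasurableSpace V] [DiscreteMeasurableSpace V]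
    (G : SimpleGraph V) [DecidableRel G.Adj] (c : Sym2 V → ℝ≥0) (u : V) :
    IsProbabilityMeasure (walkLaw G c u) := by
  unfold walkLaw; infer_instance

/-- The Markov property. -/
theorem lintegral_walkLaw_succ {V : Type*} [Fintype V] [MeasurableSpace V]
    [DiscreteMeasurableSpace V] (G : SimpleGraph V) [DecidableRel G.Adj] (c : Sym2 V → ℝ≥0) (u : V)
    (t : ℕ) (F : (Finset.Iic t → V) → V → ℝ≥0∞) :
    ∫⁻ ω, F (Preorder.frestrictLe t ω) (ω (t + 1)) ∂walkLaw G c u =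
      ∫⁻ ω, ∑ w, step G c (ω t) w * F (Preorder.frestrictLe t ω) w ∂walkLaw G c u := by
  have hm : Measurable (Function.uncurry F) := Measurable.of_discrete
  have h1 := Kernel.partialTraj_compProd_eq_map_traj (X := fun _ => V) (κ := pathKernel G c)
    (Nat.zero_le t) (x₀ := fun _ => u)
  have h2 := Kernel.traj_map_frestrictLe_apply (X := fun _ => V) (κ := pathKernel G c) 0 t
    (fun _ => u)
  have h3 : ∫⁻ ω, F (Preorder.frestrictLe t ω) (ω (t + 1)) ∂walkLaw G c u =
      ∫⁻ p, Function.uncurry F p ∂((walkLaw G c u).map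
        (fun ω => (Preorder.frestrictLe t ω, ω (t + 1)))) := by
    rw [lintegral_map hm (by fun_prop)]
    rfl
  rw [h3, walkLaw, ← h1, Measure.lintegral_compProd hm, ← h2,
    lintegral_map (Measurable.of_discrete) (by fun_prop)]
  refine lintegral_congr fun ω => ?_
  rw [lintegral_fintype]
  refine Finset.sum_congr rfl fun w _ => ?_
  rw [mul_comm]
  congr 1
  exact PMF.toMeasure_apply_singleton _ _ (MeasurableSet.singleton _)

theorem walkLaw_ae_zero {V : Type*} [Fintype V] [MeasurableSpace V] [DiscreteMeasurableSpace V]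
    (G : SimpleGraph V) [DecidableRel G.Adj] (c : Sym2 V → ℝ≥0) (u : V) :
    ∀ᵐ ω ∂walkLaw G c u, ω 0 = u := by
  have h2 := Kernel.traj_map_frestrictLe_apply (X := fun _ => V) (κ := pathKernel G c) 0 0
    (fun _ => u)
  rw [Kernel.partialTraj_self, Kernel.id_apply] at h2
  have h3 : ∀ᵐ x ∂(walkLaw G c u).map (Preorder.frestrictLe 0),
      x ⟨0, Finset.mem_Iic.2 le_rfl⟩ = u := by
    rw [walkLaw, h2, ae_dirac_eq]
    simp
  exact ae_of_ae_map (by fun_prop) h3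

section Walk

variable {V : Type*} [Fintype V] [DecidableEq V] [MeasurableSpace V] [DiscreteMeasurableSpace V]

open Classical in
/-- A nonnegative function `g` of the set of visited vertices and the position, which decreases by
one in expectation in every step before `D` holds, bounds the expected time until `D` holds. -/
theorem lintegral_stopTime_le (G : SimpleGraph V) [DecidableRel G.Adj] (c : Sym2 V → ℝ≥0)
    {D : Finset V → Prop} (hD : ∀ S w, D S → D (insert w S)) {g : Finset V → V → ℝ≥0∞}
    (hg : ∀ S, ∀ x ∈ S, ¬ D S → 1 + ∑ w, step G c x w * g (insert w S) w ≤ g S x) (u : V) :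
    ∫⁻ ω, stopTime D ω ∂walkLaw G c u ≤ g {u} u := by
  set μ := walkLaw G c u with hμ
  let g' : Finset V → V → ℝ≥0∞ := fun S x => if D S then 0 else g S x
  let a : ℕ → (ℕ → V) → ℝ≥0∞ := fun t ω => if D (visited t ω) then 0 else 1
  have hvis : ∀ (t : ℕ) (φ : Finset V → V → ℝ≥0∞),
      Measurable fun ω : ℕ → V => φ (visited t ω) (ω t) := by
    intro t φ
    let k : (Finset.Iic t → V) → ℝ≥0∞ := fun x => φ (Finset.univ.image x)
      (x ⟨t, Finset.mem_Iic.2 le_rfl⟩)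
    have hk : Measurable k := Measurable.of_discrete
    have : (fun ω : ℕ → V => φ (visited t ω) (ω t)) = k ∘ Preorder.frestrictLe t := by
      funext ω
      simp only [visited_eq_image, Function.comp, k]
      rfl
    rw [this]
    exact hk.comp (by fun_prop)
  have hma : ∀ t, Measurable (a t) := fun t => hvis t fun S _ => if D S then 0 else 1
  -- The drift condition integrated by the Markov property. Since `g'` vanishes once `D` holds and
  -- `D` persists, it holds at all times and telescopes.
  have hstep : ∀ t, ∫⁻ ω, a t ω ∂μ + ∫⁻ ω, g' (visited (t + 1) ω) (ω (t + 1)) ∂μ ≤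
      ∫⁻ ω, g' (visited t ω) (ω t) ∂μ := by
    intro t
    have h1 : ∫⁻ ω, g' (visited (t + 1) ω) (ω (t + 1)) ∂μ =
        ∫⁻ ω, ∑ w, step G c (ω t) w * g' (insert w (visited t ω)) w ∂μ := by
      have := lintegral_walkLaw_succ G c u t fun x w => g' (insert w (Finset.univ.image x)) w
      simp only [visited_succ, visited_eq_image]
      exact this
    rw [h1, ← lintegral_add_left (hma t)]
    refine lintegral_mono fun ω => ?_
    by_cases h : D (visited t ω)
    · simp [a, g', h, hD _ _ h]
    · simp only [a, g', h, if_false]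
      refine le_trans (add_le_add le_rfl (Finset.sum_le_sum fun w _ => ?_))
        (hg _ _ (mem_visited_self t ω) h)
      gcongr
      split_ifs
      · exact zero_le
      · exact le_rfl
  have hsum : ∀ n, ∑ t ∈ Finset.range n, ∫⁻ ω, a t ω ∂μ +
      ∫⁻ ω, g' (visited n ω) (ω n) ∂μ ≤ g {u} u := by
    intro n
    induction n with
    | zero =>
      rw [Finset.sum_range_zero, zero_add]
      have h0 : ∀ᵐ ω ∂μ, g' (visited 0 ω) (ω 0) ≤ g {u} u := by
        filter_upwards [walkLaw_ae_zero G c u] with ω hω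
        rw [visited_zero, hω]
        simp only [g']
        split_ifs
        · exact zero_le
        · exact le_rfl
      refine (lintegral_mono_ae h0).trans ?_
      rw [lintegral_const, measure_univ, mul_one]
    | succ n ih =>
      rw [Finset.sum_range_succ, add_assoc]
      exact (add_le_add le_rfl (hstep n)).trans ih
  calc ∫⁻ ω, stopTime D ω ∂μ ≤ ∫⁻ ω, ∑' t, a t ω ∂μ := lintegral_mono fun ω => stopTime_le_tsum D ω
    _ = ∑' t, ∫⁻ ω, a t ω ∂μ := lintegral_tsum fun t => (hma t).aemeasurable
    _ ≤ g {u} u := ENNReal.tsum_le_of_sum_range_le fun n => le_self_add.trans (hsum n)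

/-- A solution `h` of the inequalities for the hitting times bounds the hitting times. -/
theorem hittingTime_le (G : SimpleGraph V) [DecidableRel G.Adj] (c : Sym2 V → ℝ≥0)
    {h : V → V → ℝ≥0∞} (hh : ∀ v x, x ≠ v → 1 + ∑ w, step G c x w * h w v ≤ h x v) (u v : V) :
    hittingTime G c u v ≤ h u v := by
  have h1 := lintegral_stopTime_le G c (D := fun S => v ∈ S)
    (fun S w hS => Finset.mem_insert_of_mem hS) (g := fun _ x => h x v) (fun S x hx hv =>
      hh v x fun h' => hv (h' ▸ hx)) u
  refine (lintegral_mono fun ω => ?_).trans h1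
  refine le_iInf₂ fun t ht => ?_
  obtain ⟨s, hs, hsv⟩ := mem_visited.1 ht
  exact (iInf₂_le s hsv).trans (Nat.cast_le.2 hs)

/-- The walk covers the graph in expected time at most the length of a path through all vertices. -/
theorem lintegral_coverStep_le (G : SimpleGraph V) [DecidableRel G.Adj] (c : Sym2 V → ℝ≥0)
    {h : V → V → ℝ≥0∞} (hh : ∀ v x, x ≠ v → 1 + ∑ w, step G c x w * h w v ≤ h x v)
    (tri : ∀ x y z, h x z ≤ h x y + h y z) {u : V} {l : List V} (hl : ∀ v, v ∈ u :: l) :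
    ∫⁻ ω, coverStep ω ∂walkLaw G c u ≤ openPathCost h u l := by
  have h1 := lintegral_stopTime_le G c (D := fun S => ∀ v, v ∈ S)
    (fun S w hS v => Finset.mem_insert_of_mem (hS v)) (g := fun S x => remainingCost h S x (u :: l))
    (fun S x hx hS => remainingCost_step G c hh tri hx _ (by
      push Not at hS
      obtain ⟨v, hv⟩ := hS
      exact ⟨v, hl v, hv⟩)) u
  refine (lintegral_mono fun ω => ?_).trans (h1.trans ?_)
  · exact le_iInf₂ fun t ht => iInf₂_le t fun v => mem_visited.1 (ht v)
  · simpa [remainingCost] using remainingCost_le tri {u} u l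

end Walk

theorem sum_finRotate_get {V : Type*} (H : V → V → ℝ) (a z : V) (l : List V) :
    ∑ i : Fin l.length, H ((a :: l).get i.castSucc) ((a :: l).get i.succ) +
      H ((a :: l).get (Fin.last _)) z = pathCost H a l z := by
  induction l generalizing a with
  | nil => simp [pathCost]
  | cons b l ih =>
    rw [pathCost, ← ih b, ← add_assoc]
    congr 1
    exact Fin.sum_univ_succ (n := l.length) _

theorem exists_equiv_sum_eq_pathCost {V : Type*} [DecidableEq V] (H : V → V → ℝ) {a : V}
    {l : List V} (hnd : (a :: l).Nodup) (hl : ∀ v, v ∈ a :: l) {n : ℕ} (hn : n = l.length + 1) :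
    ∃ σ : Fin n ≃ V, ∑ i, H (σ i) (σ (finRotate _ i)) = pathCost H a l a := by
  subst hn
  refine ⟨hnd.getEquivOfForallMemList _ hl, ?_⟩
  -- The last index is split off because `finRotate` sends it back to `0`, which is the closing leg
  -- to `a`.
  rw [← sum_finRotate_get, Fin.sum_univ_castSucc]
  simp only [finRotate_apply, Fin.coeSucc_eq_succ, Fin.last_add_one]
  rfl

theorem openPathCost_le {V : Type*} {h : V → V → ℝ} (h0 : ∀ x y, 0 ≤ h x y) (a z : V) (l : List V) :
    openPathCost (fun x y => ENNReal.ofReal (h x y)) a l ≤ ENNReal.ofReal (pathCost h a l z) := by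
  have hp : ∀ (a : V) (l : List V), 0 ≤ pathCost h a l z := by
    intro a l
    induction l generalizing a with
    | nil => exact h0 a z
    | cons b l ih => exact add_nonneg (h0 a b) (ih b)
  induction l generalizing a with
  | nil => exact zero_le
  | cons b l ih =>
    rw [openPathCost, pathCost, ENNReal.ofReal_add (h0 a b) (hp b l)]
    exact add_le_add le_rfl (ih b)

/-! ### The potential satisfies the drift inequality of the walk -/

section Bounds

variable {V : Type*}

/-- The conductances of a graph, as a real matrix. -/
def conductanceMatrix (G : SimpleGraph V) [DecidableRel G.Adj] (c : Sym2 V → ℝ≥0) (x y : V) : ℝ :=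
  if G.Adj x y then (c s(x, y) : ℝ) else 0

theorem conductanceMatrix_nonneg (G : SimpleGraph V) [DecidableRel G.Adj] (c : Sym2 V → ℝ≥0)
    (x y : V) : 0 ≤ conductanceMatrix G c x y := by
  unfold conductanceMatrix
  split_ifs
  · exact NNReal.coe_nonneg _
  · exact le_rfl

theorem conductanceMatrix_comm (G : SimpleGraph V) [DecidableRel G.Adj] (c : Sym2 V → ℝ≥0)
    (x y : V) : conductanceMatrix G c x y = conductanceMatrix G c y x := by
  simp only [conductanceMatrix, G.adj_comm x y, Sym2.eq_swap]

variable [Fintype V]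

theorem sum_conductanceMatrix (G : SimpleGraph V) [DecidableRel G.Adj] (c : Sym2 V → ℝ≥0)
    (x : V) : ∑ w, conductanceMatrix G c x w = totalConductance G c x := by
  simp only [conductanceMatrix, totalConductance, SimpleGraph.neighborFinset_eq_filter,
    ← Finset.sum_filter, NNReal.coe_sum]

/-- This is the Laplace equation divided by the total conductance, which is positive because a
connected graph with two vertices has an edge at `x`. -/
theorem one_add_sum_step_mul_le {G : SimpleGraph V} [DecidableRel G.Adj] (hG : G.Connected)
    {c : Sym2 V → ℝ≥0} (hpos : ∀ x y, G.Adj x y → 0 < conductanceMatrix G c x y)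
    {h : V → V → ℝ} (hh : IsHittingPotential (conductanceMatrix G c) h)
    (h0 : ∀ x y, 0 ≤ h x y) {v x : V} (hxv : x ≠ v) :
    1 + ∑ w, step G c x w * ENNReal.ofReal (h w v) ≤ ENNReal.ofReal (h x v) := by
  have : Nontrivial V := ⟨x, v, hxv⟩
  obtain ⟨y, hy⟩ := hG.preconnected.exists_adj_of_nontrivial x
  have hT : 0 < (totalConductance G c x : ℝ) := by
    rw [← sum_conductanceMatrix]
    exact Finset.sum_pos' (fun w _ => conductanceMatrix_nonneg G c x w)
      ⟨y, Finset.mem_univ y, hpos x y hy⟩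
  have hstep : ∀ w, step G c x w =
      ENNReal.ofReal (conductanceMatrix G c x w / totalConductance G c x) := by
    intro w
    rw [step, dif_neg (fun h => by simp [h] at hT), PMF.ofFintype_apply, conductanceMatrix]
    split_ifs
    · rw [← NNReal.coe_div, ENNReal.ofReal_coe_nnreal]
    · simp
  have hnn : ∀ w, 0 ≤ conductanceMatrix G c x w / totalConductance G c x := fun w =>
    div_nonneg (conductanceMatrix_nonneg G c x w) hT.le
  simp only [hstep, ← ENNReal.ofReal_mul (hnn _)]
  rw [← ENNReal.ofReal_sum_of_nonneg fun w _ => mul_nonneg (hnn w) (h0 w v), ← ENNReal.ofReal_one,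
    ← ENNReal.ofReal_add zero_le_one (Finset.sum_nonneg fun w _ => mul_nonneg (hnn w) (h0 w v))]
  refine ENNReal.ofReal_le_ofReal (le_of_eq ?_)
  have h1 := hh.laplacian_eq v x hxv
  simp only [laplacian, mul_sub, Finset.sum_sub_distrib, ← Finset.sum_mul,
    sum_conductanceMatrix] at h1
  have h2 : ∑ w, conductanceMatrix G c x w / totalConductance G c x * h w v =
      (∑ w, conductanceMatrix G c x w * h w v) / totalConductance G c x := by
    rw [Finset.sum_div]
    exact Finset.sum_congr rfl fun w _ => div_mul_eq_mul_div _ _ _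
  rw [h2]
  field_simp
  linarith

end Bounds

/-! ### Minimum degree conductances -/

section MinDegree

variable {V : Type*} [Fintype V]

theorem conductanceMatrix_minDegree (G : SimpleGraph V) [DecidableRel G.Adj] (x y : V) :
    conductanceMatrix G (minDegreeConductance G) x y =
      if G.Adj x y then 1 / min (G.degree x : ℝ) (G.degree y) else 0 := by
  simp [conductanceMatrix, minDegreeConductance]

/-- Each conductance is at most `1 / d(x) + 1 / d(y)`, and the values `1 / d(x)` over the neighbours
of `x` sum to at most `1`. -/
theorem sum_conductanceMatrix_minDegree_le (G : SimpleGraph V) [DecidableRel G.Adj] :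
    ∑ x, ∑ y, conductanceMatrix G (minDegreeConductance G) x y ≤ 2 * Fintype.card V := by
  have h1 : ∑ x, ∑ y ∈ G.neighborFinset x, 1 / (G.degree x : ℝ) ≤ Fintype.card V := by
    calc ∑ x, ∑ y ∈ G.neighborFinset x, 1 / (G.degree x : ℝ) ≤ ∑ _x : V, (1 : ℝ) := by
          refine Finset.sum_le_sum fun x _ => ?_
          rw [Finset.sum_const, G.card_neighborFinset_eq_degree, nsmul_eq_mul, mul_one_div]
          exact div_self_le_one _
      _ = Fintype.card V := by simp
  have h2 : ∑ x, ∑ y ∈ G.neighborFinset x, 1 / (G.degree y : ℝ) =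
      ∑ x, ∑ y ∈ G.neighborFinset x, 1 / (G.degree x : ℝ) :=
    Finset.sum_comm' fun x y => by simp [G.adj_comm]
  have h3 : ∑ x, ∑ y, conductanceMatrix G (minDegreeConductance G) x y ≤
      ∑ x, ∑ y ∈ G.neighborFinset x, (1 / (G.degree x : ℝ) + 1 / (G.degree y : ℝ)) := by
    refine Finset.sum_le_sum fun x _ => ?_
    simp only [conductanceMatrix_minDegree]
    rw [← Finset.sum_filter, ← SimpleGraph.neighborFinset_eq_filter]
    refine Finset.sum_le_sum fun y _ => ?_
    have hx : 0 ≤ 1 / (G.degree x : ℝ) := by positivity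
    have hy : 0 ≤ 1 / (G.degree y : ℝ) := by positivity
    rcases min_choice (G.degree x : ℝ) (G.degree y) with h | h <;> rw [h] <;> linarith
  simp only [Finset.sum_add_distrib] at h3
  linarith

variable [DecidableEq V]

/-- A solution of the equations for the hitting times of the minimum degree walk has a short tour. -/
theorem hasTour_minDegree {G : SimpleGraph V} [DecidableRel G.Adj] (hG : G.Connected)
    {h : V → V → ℝ}
    (hh : IsHittingPotential (conductanceMatrix G (minDegreeConductance G)) h) :
    HasTour h Set.univ (8 * (Fintype.card V : ℝ) ^ 2) := by
  set C := conductanceMatrix G (minDegreeConductance G) with hC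
  have hC0 : ∀ x y, 0 ≤ C x y := conductanceMatrix_nonneg _ _
  have hCs : ∀ x y, C x y = C y x := conductanceMatrix_comm _ _
  have hmin : ∀ x y, G.Adj x y → 0 < min (G.degree x : ℝ) (G.degree y) := fun x y hxy =>
    lt_min (Nat.cast_pos.2 ((G.degree_pos_iff_exists_adj x).2 ⟨y, hxy⟩))
      (Nat.cast_pos.2 ((G.degree_pos_iff_exists_adj y).2 ⟨x, hxy.symm⟩))
  have hCadj : ∀ x y, G.Adj x y → C x y = 1 / min (G.degree x : ℝ) (G.degree y) := fun x y hxy => by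
    rw [hC, conductanceMatrix_minDegree, if_pos hxy]
  have hCpos : ∀ x y, G.Adj x y → 0 < C x y := fun x y hxy => by
    rw [hCadj x y hxy]
    exact one_div_pos.2 (hmin x y hxy)
  have hnn := hh.nonneg hG hC0 hCpos
  set M := ∑ x, ∑ w, C x w with hMdef
  have hM0 : 0 ≤ M := Finset.sum_nonneg fun x _ => Finset.sum_nonneg fun w _ => hC0 x w
  have hMle : M ≤ 2 * Fintype.card V := sum_conductanceMatrix_minDegree_le G
  obtain ⟨rank, hrank, hdeg⟩ : ∃ rank : V → ℕ, Function.Injective rank ∧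
      ∀ x y, rank x ≤ rank y → G.degree x ≤ G.degree y := by
    let e := Fintype.equivFin V
    -- Lexicographic order, by degree and then by `e`: the remainder modulo `n` recovers `e x`, the
    -- quotient the degree.
    refine ⟨fun x => e x + Fintype.card V * G.degree x, fun x y hxy => ?_, fun x y hxy => ?_⟩
    · have := congrArg (· % Fintype.card V) hxy
      simp only [Nat.add_mul_mod_self_left, Nat.mod_eq_of_lt (e _).2] at this
      exact e.injective (Fin.ext this)
    · have := Nat.div_le_div_right (c := Fintype.card V) hxy
      have hpos : 0 < Fintype.card V := Fintype.card_pos_iff.2 ⟨x⟩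
      simpa only [Nat.add_mul_div_left _ _ hpos, Nat.div_eq_of_lt (e _).2, zero_add] using this
  have hKD : ∀ x y, G.Adj x y → h x y + h y x ≤ M * G.degree x := by
    intro x y hxy
    have h1 := hh.commute_le hG hC0 hCpos hCs x y
    rw [hCadj x y hxy, one_div_mul_eq_div, div_le_iff₀ (hmin x y hxy)] at h1
    exact h1.trans (mul_le_mul_of_nonneg_left (min_le_left _ _) hM0)
  obtain ⟨b, B, htour, hmem, hmax, hleave, hle⟩ := exists_tour hG hrank
    (D := fun x => M * G.degree x) hh.self hnn (hh.triangle hG hC0 hCpos)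
    (fun x => mul_nonneg hM0 (Nat.cast_nonneg _))
    (fun x y hxy => mul_le_mul_of_nonneg_left (Nat.cast_le.2 (hdeg x y hxy)) hM0) hKD
  refine htour.mono ?_
  -- A single vertex has degree `0`, which the charging argument excludes; there `b u ≤ M * 0`.
  rcases subsingleton_or_nontrivial V with hV | hV
  · have hb : ∀ u, b u ≤ 0 := fun u => (hle u).trans (by simp)
    exact (Finset.sum_nonpos fun u _ => hb u).trans (by positivity)
  · have hsum := sum_merge_cost_le (K := fun x y => h x y + h y x)
      (F := (Fintype.card V - 1) * M) hrank hdeg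
      (fun x => (G.degree_pos_iff_exists_adj x).2 (hG.preconnected.exists_adj_of_nontrivial x))
      (fun x y => add_nonneg (hnn x y) (hnn y x)) (fun x y => add_comm _ _) hM0 (by
        rw [← hh.foster hCs]
        refine Finset.sum_le_sum fun x _ => le_of_eq ?_
        rw [SimpleGraph.neighborFinset_eq_filter, Finset.sum_filter]
        refine Finset.sum_congr rfl fun y _ => ?_
        by_cases hxy : G.Adj x y
        · rw [if_pos hxy, hCadj x y hxy, one_div_mul_eq_div]
        · rw [if_neg hxy, hC, conductanceMatrix_minDegree, if_neg hxy, zero_mul])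
      hmem hmax hleave hle
    have hn : (0 : ℝ) ≤ Fintype.card V := Nat.cast_nonneg _
    -- `3(n - 1)M + nM ≤ 4nM ≤ 8n²`.
    nlinarith [mul_le_mul_of_nonneg_left hMle hn]

end MinDegree

end GraphWalk

end

theorem theorem1 {V : Type*} [Fintype V] [DecidableEq V] [MeasurableSpace V]
    [DiscreteMeasurableSpace V] (G : SimpleGraph V) [DecidableRel G.Adj] (hG : G.Connected) :
    GraphWalk.cyclicCoverTime G (GraphWalk.minDegreeConductance G)
        ≤ 18 * (Fintype.card V : ℝ≥0∞) ^ 2 ∧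
      GraphWalk.coverTime G (GraphWalk.minDegreeConductance G)
        ≤ 18 * (Fintype.card V : ℝ≥0∞) ^ 2 := by
  set c := GraphWalk.minDegreeConductance G with hc
  have hC0 := GraphWalk.conductanceMatrix_nonneg G c
  have hCpos : ∀ x y, G.Adj x y → 0 < GraphWalk.conductanceMatrix G c x y := fun x y hxy => by
    have hx := (G.degree_pos_iff_exists_adj x).2 ⟨y, hxy⟩
    have hy := (G.degree_pos_iff_exists_adj y).2 ⟨x, hxy.symm⟩
    rw [hc, GraphWalk.conductanceMatrix_minDegree, if_pos hxy]
    positivity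
  choose f hf0 hf using GraphWalk.exists_hitting_potential hG hC0 hCpos
  let h : V → V → ℝ := fun x v => f v x
  have hh : GraphWalk.IsHittingPotential (GraphWalk.conductanceMatrix G c) h := ⟨hf0, hf⟩
  have hnn := hh.nonneg hG hC0 hCpos
  have hstep : ∀ v x, x ≠ v → 1 + ∑ w, GraphWalk.step G c x w * ENNReal.ofReal (h w v) ≤
      ENNReal.ofReal (h x v) := fun v x hxv =>
    GraphWalk.one_add_sum_step_mul_le hG hCpos hh hnn hxv
  have htour := GraphWalk.hasTour_minDegree hG hh
  have hbound : ∀ r : ℝ, r ≤ 8 * (Fintype.card V : ℝ) ^ 2 →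
      ENNReal.ofReal r ≤ 18 * (Fintype.card V : ℝ≥0∞) ^ 2 := by
    intro r hr
    -- The argument gives the constant `8`, so `18` leaves room.
    have h1 : r ≤ 18 * (Fintype.card V : ℝ) ^ 2 := hr.trans (by gcongr; norm_num)
    refine (ENNReal.ofReal_le_ofReal h1).trans (le_of_eq ?_)
    rw [ENNReal.ofReal_mul (by norm_num), ENNReal.ofReal_pow (Nat.cast_nonneg _),
      ENNReal.ofReal_natCast]
    norm_num
  constructor
  · obtain ⟨a⟩ := hG.nonempty
    obtain ⟨l, hnd, hmem, hr⟩ := htour a trivial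
    have hcard : Fintype.card V = l.length + 1 := by
      have h1 : (a :: l).toFinset = Finset.univ :=
        Finset.eq_univ_iff_forall.2 fun v => List.mem_toFinset.2 ((hmem v).2 trivial)
      rw [← Finset.card_univ, ← h1, List.toFinset_card_of_nodup hnd, List.length_cons]
    obtain ⟨σ, hσ⟩ := GraphWalk.exists_equiv_sum_eq_pathCost h hnd (fun v => (hmem v).2 trivial)
      hcard
    refine (iInf_le _ σ).trans (le_trans ?_ (hbound _ hr))
    rw [← hσ, ENNReal.ofReal_sum_of_nonneg fun i _ => hnn _ _]
    exact Finset.sum_le_sum fun i _ =>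
      GraphWalk.hittingTime_le G c (h := fun x y => ENNReal.ofReal (h x y)) hstep _ _
  · refine iSup_le fun u => ?_
    obtain ⟨l, -, hmem, hr⟩ := htour u trivial
    refine le_trans ?_ (hbound _ hr)
    refine (GraphWalk.lintegral_coverStep_le G c (h := fun x y => ENNReal.ofReal (h x y)) hstep
      (fun x y z => ?_) fun v => (hmem v).2 trivial).trans (GraphWalk.openPathCost_le hnn u u l)
    rw [← ENNReal.ofReal_add (hnn x y) (hnn y z)]
    exact ENNReal.ofReal_le_ofReal (hh.triangle hG hC0 hCpos x y z)
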